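/- Let $\alpha>-1$ be a real number and $K\ge 1$ an integer. Let $L_n^\alpha(x)=\sum_{j=0}^n\binom{n+\alpha}{n-j}\frac{(-x)^j}{j!}$ be the Laguerre polynomials and $\hat L_n^\alpha=(-1)^n n!\,L_n^\alpha$ the monic ones. Let $\gamma_0,\dots,\gamma_K$ be real numbers with $\gamma_0=1$ and $\gamma_K\neq 0$, and put $$q_n(x)=\sum_{j=0}^K\gamma_j\hat L^\alpha_{n-j}(x)\quad (n\ge K),\qquad Q(x)=\sum_{j=0}^K(-1)^j\gamma_j\,(x)_{K-j},$$ where $(x)_s=x(x+1)\cdots(x+s-1)$. Let $\theta_1\le\dots\le\theta_m$ be the real zeros of $Q$ with $\theta_j\ge\alpha+1$, repeated according to multiplicity ($m=0$ is allowed). (1) If $Q$ has only real zeros, then all the zeros of $q_n$ are real and simple for every $n\ge n_1$, and all the zeros of $q_n$ are positive and simple for every $n\ge n_0$, where, for $l=0,1$, $$n_l=\max\bigl(\{K\}\cup\{\lfloor\theta_i-\alpha+K\rfloor: 1\le i\le m-l\}\bigr).$$ In particular, if all the zeros of $Q$ are real and less than $\alpha+1$, then $n_0=n_1=K$. (2)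 If $Q$ has non-real zeros, then there is an integer $n_0\ge K$ which, for the given $\alpha$ and $K$, depends only on the non-real zeros of $Q$ and on the real zeros $\theta_1,\dots,\theta_m$ (with multiplicities), such that all the zeros of $q_n$ are positive and simple for every $n\ge n_0$. (3) In all cases, there is $N\ge K$ such that for every $n\ge N$ the zeros of $q_{n+1}$ interlace the zeros of $q_n$. Here a finite set $U\subset\mathbb R$ interlaces a finite set $V\subset\mathbb R$ if $U'=U\setminus(U\cap V)$ and $V'=V\setminus (U\cap V)$ satisfy: $\min U'<\min V'$, and between any two consecutive elements of either of $U'$, $V'$ there is an element of the other. -/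

import Mathlib

open Polynomial

namespace LaguerreComb

noncomputable section

/-- The Laguerre polynomial
`L_n^α(x) = ∑_{j=0}^n binom(n+α, n-j) (-x)^j / j!`, where the generalized binomial coefficient is
`binom(n+α, n-j) = (α+j+1)(α+j+2)⋯(α+n) / (n-j)!`. -/
def laguerre (α : ℝ) (n : ℕ) : ℝ[X] :=
  ∑ j ∈ Finset.range (n + 1),
    C ((-1) ^ j / (j.factorial : ℝ) *
      ((ascPochhammer ℝ (n - j)).eval (α + j + 1) / ((n - j).factorial : ℝ))) * X ^ j

/-- The monic Laguerre polynomial: the leading coefficient of `L_n^α` is `(-1)^n / n!`. -/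
def monicLaguerre (α : ℝ) (n : ℕ) : ℝ[X] :=
  C ((-1) ^ n * (n.factorial : ℝ)) * laguerre α n

/-- `q_n = ∑_{j=0}^K γ_j \hat L^α_{n-j}`; it is only used for `K ≤ n`. -/
def q (α : ℝ) (K : ℕ) (γ : ℕ → ℝ) (n : ℕ) : ℝ[X] :=
  ∑ j ∈ Finset.range (K + 1), C (γ j) * monicLaguerre α (n - j)

/-- `Q(x) = ∑_{j=0}^K (-1)^j γ_j (x)_{K-j}`, with `(x)_s = x(x+1)⋯(x+s-1)`. -/
def Q (K : ℕ) (γ : ℕ → ℝ) : ℝ[X] :=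
  ∑ j ∈ Finset.range (K + 1), C ((-1) ^ j * γ j) * ascPochhammer ℝ (K - j)

/-- All complex zeros of the real polynomial `p` are real. -/
def OnlyRealZeros (p : ℝ[X]) : Prop :=
  ∀ z : ℂ, aeval z p = 0 → z.im = 0

/-- All complex zeros of the real polynomial `p` are positive real numbers. -/
def OnlyPositiveZeros (p : ℝ[X]) : Prop :=
  ∀ z : ℂ, aeval z p = 0 → z.im = 0 ∧ 0 < z.re

/-- All complex zeros of the real polynomial `p` are simple. -/
def OnlySimpleZeros (p : ℝ[X]) : Prop :=
  ∀ z : ℂ, aeval z p = 0 → (p.map (algebraMap ℝ ℂ)).rootMultiplicity z = 1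

/-- The real zeros `θ_1 ≤ ⋯ ≤ θ_m` of `p` that are at least `α + 1`, repeated according to their
multiplicities and listed in increasing order. -/
def largeZeros (α : ℝ) (p : ℝ[X]) : List ℝ :=
  (p.roots.filter (fun x => α + 1 ≤ x)).sort (· ≤ ·)

/-- `n_l = max {K, ⌊θ_i - α + K⌋ : 1 ≤ i ≤ m - l}`. All the numbers `θ_i - α + K` are positive, so
that the natural floor is the integer floor. -/
def threshold (α : ℝ) (K : ℕ) (γ : ℕ → ℝ) (l : ℕ) : ℕ :=
  (((largeZeros α (Q K γ)).take ((largeZeros α (Q K γ)).length - l)).map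
    (fun θ => ⌊θ - α + K⌋₊)).foldr max K

open Classical in
/-- The multiset (zeros counted with multiplicity) of those complex zeros of `p` that are non-real,
or real and at least `α + 1`. -/
def exceptionalZeros (α : ℝ) (p : ℝ[X]) : Multiset ℂ :=
  (p.aroots ℂ).filter (fun z => z.im ≠ 0 ∨ α + 1 ≤ z.re)

/-- `a < b` are consecutive elements of `U`. -/
def Consecutive (U : Finset ℝ) (a b : ℝ) : Prop :=
  a ∈ U ∧ b ∈ U ∧ a < b ∧ ∀ c ∈ U, ¬ (a < c ∧ c < b)

/-- `U` strictly interlaces `V`: `min U < min V`, and between any two consecutive elements of any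
of the two sets there is an element of the other. -/
def StrictlyInterlaces (U V : Finset ℝ) : Prop :=
  (∃ u ∈ U, ∀ v ∈ V, u < v) ∧
  (∀ a b, Consecutive U a b → ∃ v ∈ V, a < v ∧ v < b) ∧
  (∀ a b, Consecutive V a b → ∃ u ∈ U, a < u ∧ u < b)

/-- `U` interlaces `V`: after removal of the common elements, `U` strictly interlaces `V`. -/
def Interlaces (U V : Finset ℝ) : Prop :=
  StrictlyInterlaces (U \ (U ∩ V)) (V \ (U ∩ V))

end

end LaguerreComb

/-!
The monic Laguerre polynomials satisfy `L̂_{n+1} = -e^x (x d/dx + α + n + 1) e^{-x} L̂_n`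
(`monicLaguerre_succ`). Hence, with `m = n - K`, the combination `q_n` is `(-1)^K Q(A) L̂_m`, where
`A = e^x (x d/dx + α + m + 1) e^{-x}` (`q_eq_aeval`), and each real zero `θ` of `Q` contributes a
factor `-e^x (x d/dx + a) e^{-x}` with `a = α + m + 1 - θ`. Such a factor maps `p` to a polynomial
with the value `-x p'(x)` at the zeros of `p`. If `p` has only simple positive zeros, the signs
of these values alternate, so that the image has only real simple zeros, and they are positive if
`a > 0` (`HasSimpleZeros.neg_shiftedEulerOp`). The thresholds say that `a > 0` for all the zeros of
`Q`, or for all but the largest one, whose factor is applied last. This gives the case of a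
real-rooted `Q`.

For large `n`, the three-term recurrence, read backwards, bounds `L̂_{n-j}` on `[0, ∞)` by
`n^{-j} (|L̂_n| + n |L̂_{n-1}|)` up to a constant (`pow_mul_abs_eval_monicLaguerre_le`), so that
`|q_n - L̂_n| ≤ (C / n) (|L̂_n| + n |L̂_{n-1}|)` there. At `0` and at the zeros of `L̂_{n-1}`
the sign of `q_n` is therefore that of `L̂_n`; these signs alternate, and all the zeros of `q_n` are
positive, simple, and separated by the zeros of `L̂_{n-1}` (`IsLargeIndex.exists_zeros`). At a zero
of `q_n` one has `|L̂_n| ≤ 2 C |L̂_{n-1}|`, so that `q_{n+1}` is dominated by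
`-n (n + α) L̂_{n-1}` (`IsLargeIndex.sign_succ`). By the separation the signs of `L̂_{n-1}` alternate
at the zeros of `q_n`, hence so do those of `q_{n+1}`, which is the interlacing.

If `Q` has non-real zeros, write `Q = S R`, where the zeros of `R` are the exceptional ones and those
of `S` are real and less than `α + 1`. Since the rising factorials form a basis, `R` is itself a
polynomial of the form `Q`, and the result for large `n` provides an index, depending on `R` only,
from which on `R(A) L̂_m` has only simple positive zeros. The factors of `S` preserve this
property for every `m`, because for them `a > 0`.
-/

namespace LaguerreComb

/-! ### Real polynomials with simple zeros and sign changes -/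

/-- `p = ∏_{i < N} (X - u_i)` with `u_0 < ⋯ < u_{N-1}`; the values `u_i` with `i ≥ N` are
irrelevant. -/
structure HasSimpleZeros (p : ℝ[X]) (N : ℕ) (u : ℕ → ℝ) : Prop where
  eq_prod : p = ∏ i ∈ Finset.range N, (X - C (u i))
  strictMonoOn : StrictMonoOn u (Set.Iio N)

/-- `p` is monic of degree `N` and has `N` simple positive zeros. -/
def PosSimple (p : ℝ[X]) (N : ℕ) : Prop :=
  ∃ u : ℕ → ℝ, HasSimpleZeros p N u ∧ ∀ i < N, 0 < u i

/-- Exactly the `N - k` factors with index at least `k` are negative. -/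
theorem prod_sub_sign {u : ℕ → ℝ} {N k : ℕ} {x : ℝ}
    (h1 : ∀ i < k, u i < x) (h2 : ∀ i, k ≤ i → i < N → x < u i) :
    0 < (-1) ^ (N - k) * ∏ i ∈ Finset.range N, (x - u i) := by
  have hc : ∏ i ∈ Finset.range N, (if i < k then (1 : ℝ) else -1) = (-1) ^ (N - k) := by
    rw [Finset.prod_ite, Finset.prod_const_one, one_mul, Finset.prod_const]
    congr 1
    rw [← Nat.card_Ico]
    congr 1
    ext i
    simp
    omega
  rw [← hc, ← Finset.prod_mul_distrib]
  refine Finset.prod_pos fun i hi => ?_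
  split_ifs with h
  · linarith [h1 i h]
  · linarith [h2 i (not_lt.1 h) (Finset.mem_range.1 hi)]

namespace HasSimpleZeros

variable {p : ℝ[X]} {N : ℕ} {u : ℕ → ℝ}

theorem monic (h : HasSimpleZeros p N u) : p.Monic := by
  rw [h.eq_prod]
  exact monic_prod_of_monic _ _ fun i _ => monic_X_sub_C _

theorem natDegree (h : HasSimpleZeros p N u) : p.natDegree = N := by
  rw [h.eq_prod, natDegree_prod_of_monic _ _ fun i _ => monic_X_sub_C _]
  simp

theorem eval_eq (h : HasSimpleZeros p N u) (x : ℝ) :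
    p.eval x = ∏ i ∈ Finset.range N, (x - u i) := by
  rw [h.eq_prod, eval_prod]
  simp

theorem eval_zero (h : HasSimpleZeros p N u) {i : ℕ} (hi : i < N) : p.eval (u i) = 0 := by
  rw [h.eval_eq]
  exact Finset.prod_eq_zero (Finset.mem_range.2 hi) (sub_self _)

theorem eval_sign (h : HasSimpleZeros p N u) {k : ℕ} {x : ℝ}
    (h1 : ∀ i < k, u i < x) (h2 : ∀ i, k ≤ i → i < N → x < u i) :
    0 < (-1) ^ (N - k) * p.eval x := by
  rw [h.eval_eq]
  exact prod_sub_sign h1 h2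

theorem derivative_sign (h : HasSimpleZeros p N u) {k : ℕ} (hk : k < N) :
    0 < (-1) ^ (N - 1 - k) * p.derivative.eval (u k) := by
  have hd : p.derivative.eval (u k) = ∏ i ∈ (Finset.range N).erase k, (u k - u i) := by
    rw [h.eq_prod, ← Finset.mul_prod_erase _ _ (Finset.mem_range.2 hk), derivative_mul]
    simp [eval_prod]
  have hc : ∏ i ∈ (Finset.range N).erase k, (if i < k then (1 : ℝ) else -1) =
      (-1) ^ (N - 1 - k) := by
    rw [Finset.prod_ite, Finset.prod_const_one, one_mul, Finset.prod_const]
    congr 1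
    have : N - 1 - k = N - k - 1 := by omega
    rw [this, ← Nat.card_Ioo]
    congr 1
    ext i
    simp
    omega
  rw [hd, ← hc, ← Finset.prod_mul_distrib]
  refine Finset.prod_pos fun i hi => ?_
  obtain ⟨hik, hiN⟩ := Finset.mem_erase.1 hi
  rw [Finset.mem_range] at hiN
  split_ifs with hlt
  · linarith [h.strictMonoOn hiN hk hlt]
  · linarith [h.strictMonoOn hk hiN (by omega)]

theorem roots_eq (h : HasSimpleZeros p N u) :
    p.roots.toFinset = (Finset.range N).image u := by
  ext x
  rw [Multiset.mem_toFinset, mem_roots h.monic.ne_zero, IsRoot.def, h.eval_eq,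
    Finset.prod_eq_zero_iff]
  simp only [Finset.mem_image, sub_eq_zero, eq_comm]

theorem aeval_eq_zero (h : HasSimpleZeros p N u) {z : ℂ} (hz : aeval z p = 0) :
    ∃ i < N, z = u i := by
  rw [h.eq_prod, map_prod, Finset.prod_eq_zero_iff] at hz
  obtain ⟨i, hi, hz⟩ := hz
  refine ⟨i, Finset.mem_range.1 hi, ?_⟩
  simpa [sub_eq_zero] using hz

theorem onlyRealZeros (h : HasSimpleZeros p N u) : OnlyRealZeros p := by
  intro z hz
  obtain ⟨i, -, rfl⟩ := h.aeval_eq_zero hz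
  simp

theorem onlyPositiveZeros (h : HasSimpleZeros p N u) (hu : ∀ i < N, 0 < u i) :
    OnlyPositiveZeros p := by
  intro z hz
  obtain ⟨i, hi, rfl⟩ := h.aeval_eq_zero hz
  simpa using hu i hi

theorem onlySimpleZeros (h : HasSimpleZeros p N u) : OnlySimpleZeros p := by
  intro z hz
  obtain ⟨i, hi, rfl⟩ := h.aeval_eq_zero hz
  have hp : p.rootMultiplicity (u i) = 1 := by
    have hle := (one_lt_rootMultiplicity_iff_isRoot (t := u i) h.monic.ne_zero).not.2 (by
      rintro ⟨-, hd⟩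
      have := h.derivative_sign hi
      rw [IsRoot.def.1 hd] at this
      simp at this)
    have hpos := (rootMultiplicity_pos h.monic.ne_zero).2 (IsRoot.def.2 (h.eval_zero hi))
    omega
  rw [← hp]
  exact (eq_rootMultiplicity_map (algebraMap ℝ ℂ).injective (u i)).symm

end HasSimpleZeros

theorem PosSimple.onlyPositiveZeros_and {p : ℝ[X]} {N : ℕ} (h : PosSimple p N) :
    OnlyPositiveZeros p ∧ OnlySimpleZeros p := by
  obtain ⟨u, hu, hu0⟩ := h
  exact ⟨hu.onlyPositiveZeros hu0, hu.onlySimpleZeros⟩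

theorem exists_root_of_signs {p : ℝ[X]} {a b e : ℝ} (hab : a < b) (ha : 0 < -e * p.eval a)
    (hb : 0 < e * p.eval b) : ∃ c, a < c ∧ c < b ∧ p.eval c = 0 := by
  have hcont : ContinuousOn (fun x => e * p.eval x) (Set.Icc a b) :=
    (continuous_const.mul p.continuous).continuousOn
  obtain ⟨c, ⟨hac, hcb⟩, hc⟩ := intermediate_value_Ioo hab.le hcont
    (show (0 : ℝ) ∈ Set.Ioo _ _ from ⟨by linarith, hb⟩)
  refine ⟨c, hac, hcb, ?_⟩
  have he : e ≠ 0 := by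
    rintro rfl
    simp at hb
  simpa [he] using hc

theorem exists_gt_eval_pos {p : ℝ[X]} (hp : p.Monic) (hd : 0 < p.natDegree) (a : ℝ) :
    ∃ b, a < b ∧ 0 < p.eval b := by
  have ht := p.tendsto_atTop_of_leadingCoeff_nonneg (natDegree_pos_iff_degree_pos.1 hd)
    (by simp [hp.leadingCoeff])
  obtain ⟨b, hb⟩ := ((Filter.eventually_gt_atTop a).and
    (ht.eventually (Filter.eventually_gt_atTop 0))).exists
  exact ⟨b, hb⟩

theorem exists_lt_eval_sign {p : ℝ[X]} (hp : p.Monic) (hd : 0 < p.natDegree) (a : ℝ) :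
    ∃ b, b < a ∧ 0 < (-1) ^ p.natDegree * p.eval b := by
  obtain ⟨b, hb, hpb⟩ := exists_gt_eval_pos (p := C ((-1) ^ p.natDegree) * p.comp (-X))
    (by
      rw [Monic, leadingCoeff_mul, leadingCoeff_C, leadingCoeff_comp (by simp)]
      simp [hp.leadingCoeff, ← mul_pow])
    (by
      rw [natDegree_C_mul (by simp), natDegree_comp]
      simpa using hd) (-a)
  exact ⟨-b, by linarith, by simpa using hpb⟩

/-- A monic polynomial of degree `N` whose signs alternate at `N` points in the way prescribed by
its sign at `+∞` has a simple zero to the right of each of these points. -/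
theorem exists_hasSimpleZeros {p : ℝ[X]} {N : ℕ} {s : ℕ → ℝ} (hp : p.Monic)
    (hd : p.natDegree = N) (hs : StrictMonoOn s (Set.Iio N))
    (hsign : ∀ i < N, 0 < (-1) ^ (N - i) * p.eval (s i)) :
    ∃ u, HasSimpleZeros p N u ∧ (∀ i < N, s i < u i) ∧ ∀ i, i + 1 < N → u i < s (i + 1) := by
  have hroot : ∀ i, ∃ c, i < N → s i < c ∧ (i + 1 < N → c < s (i + 1)) ∧ p.eval c = 0 := by
    intro i
    by_cases hi : i < N
    swap
    · exact ⟨0, fun h => absurd h hi⟩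
    have hi' := hsign i hi
    have e1 : N - i = N - (i + 1) + 1 := by omega
    rw [e1, pow_succ, mul_neg_one] at hi'
    by_cases hi1 : i + 1 < N
    · obtain ⟨c, h1, h2, h3⟩ := exists_root_of_signs (hs hi hi1 (Nat.lt_succ_self i)) hi'
        (hsign _ hi1)
      exact ⟨c, fun _ => ⟨h1, fun _ => h2, h3⟩⟩
    · obtain ⟨b, hb, hpb⟩ := exists_gt_eval_pos hp (by omega) (s i)
      have e2 : N - (i + 1) = 0 := by omega
      rw [e2] at hi'
      obtain ⟨c, h1, h2, h3⟩ := exists_root_of_signs hb hi' (by simpa using hpb)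
      exact ⟨c, fun _ => ⟨h1, fun h => absurd h hi1, h3⟩⟩
  choose u hu using hroot
  have hmono : StrictMonoOn u (Set.Iio N) := by
    intro i hi j hj hij
    simp only [Set.mem_Iio] at hi hj
    have h1 : i + 1 < N := by omega
    calc u i < s (i + 1) := (hu i hi).2.1 h1
      _ ≤ s j := hs.monotoneOn h1 hj (by omega)
      _ < u j := (hu j hj).1
  refine ⟨u, ⟨?_, hmono⟩, fun i hi => (hu i hi).1, fun i hi => (hu i (by omega)).2.1 hi⟩
  have hm : (∏ i ∈ Finset.range N, (X - C (u i))).Monic :=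
    monic_prod_of_monic _ _ fun i _ => monic_X_sub_C _
  refine eq_of_monic_of_dvd_of_natDegree_le hm hp ?_ ?_
  · refine Finset.prod_dvd_of_coprime ?_ ?_
    · intro i hi j hj hij
      simp only [Finset.coe_range] at hi hj
      refine isCoprime_X_sub_C_of_isUnit_sub ?_
      rw [isUnit_iff_ne_zero, sub_ne_zero]
      exact fun h => hij (hmono.injOn hi hj h)
    · intro i hi
      exact dvd_iff_isRoot.2 (hu i (Finset.mem_range.1 hi)).2.2
  · rw [natDegree_prod_of_monic _ _ fun i _ => monic_X_sub_C _, hd]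
    simp

/-! ### The operators `x d/dx + c` conjugated by `e^{-x}` -/

/-- The operator `p ↦ x p' - x p`, that is, `e^x ∘ (x d/dx) ∘ e^{-x}`. -/
noncomputable def eulerOp : Module.End ℝ ℝ[X] :=
  LinearMap.mulLeft ℝ X ∘ₗ derivative - LinearMap.mulLeft ℝ X

theorem eulerOp_apply (p : ℝ[X]) : eulerOp p = X * derivative p - X * p := rfl

/-- The operator `e^x ∘ (x d/dx + c) ∘ e^{-x}`. -/
noncomputable def shiftedEulerOp (c : ℝ) : Module.End ℝ ℝ[X] := eulerOp + algebraMap ℝ _ c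

theorem shiftedEulerOp_apply (c : ℝ) (p : ℝ[X]) :
    shiftedEulerOp c p = X * derivative p - X * p + C c * p := by
  simp [shiftedEulerOp, eulerOp_apply, smul_eq_C_mul]

theorem aeval_shiftedEulerOp_X_sub_C (c r : ℝ) (p : ℝ[X]) :
    aeval (shiftedEulerOp c) (X - C r) p = shiftedEulerOp (c - r) p := by
  simp [shiftedEulerOp, add_sub_assoc]

theorem aeval_shiftedEulerOp_X_add_C (c r : ℝ) (p : ℝ[X]) :
    aeval (shiftedEulerOp c) (X + C r) p = shiftedEulerOp (c + r) p := by
  simp [shiftedEulerOp, add_assoc]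

section Step

variable {p : ℝ[X]} {N : ℕ} {u : ℕ → ℝ}

theorem monic_neg_shiftedEulerOp (hp : p.Monic) (a : ℝ) : (-shiftedEulerOp a p).Monic ∧
    (-shiftedEulerOp a p).natDegree = p.natDegree + 1 := by
  have he : -shiftedEulerOp a p = X * p - (X * derivative p + C a * p) := by
    rw [shiftedEulerOp_apply]
    ring
  have hlt : (X * derivative p + C a * p).degree < (X * p).degree := by
    have h1 : (X * p).degree = ((p.natDegree + 1 : ℕ) : WithBot ℕ) := by
      rw [degree_mul, degree_X, degree_eq_natDegree hp.ne_zero]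
      push_cast
      ring
    have h2 : (X * derivative p + C a * p).natDegree ≤ p.natDegree := by
      refine natDegree_add_le_of_degree_le ?_ (natDegree_C_mul_le a p)
      by_cases h0 : p.natDegree = 0
      · rw [natDegree_eq_zero.1 h0 |>.choose_spec.symm]
        simp
      · refine natDegree_mul_le.trans ?_
        have := natDegree_derivative_lt h0
        rw [natDegree_X]
        omega
    rw [h1]
    exact lt_of_le_of_lt degree_le_natDegree (by exact_mod_cast Nat.lt_succ_of_le h2)
  rw [he]
  refine ⟨(monic_X.mul hp).sub_of_left hlt, ?_⟩
  rw [natDegree_eq_of_degree_eq (degree_sub_eq_left_of_degree_lt hlt), natDegree_X_mul hp.ne_zero]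

theorem eval_neg_shiftedEulerOp (a x : ℝ) (p : ℝ[X]) : (-shiftedEulerOp a p).eval x =
    x * p.eval x - a * p.eval x - x * p.derivative.eval x := by
  rw [shiftedEulerOp_apply]
  simp
  ring

/-- At the zeros of `p` the image of `p` equals `-x p'(x)`, so that its signs alternate there. Any
further point on the left at which the image has the next sign gives all its zeros. -/
theorem HasSimpleZeros.neg_shiftedEulerOp (h : HasSimpleZeros p N u) (hu : ∀ i < N, 0 < u i)
    (a b : ℝ) (hb : ∀ i < N, b < u i)
    (hsign : 0 < (-1) ^ (N + 1) * (-shiftedEulerOp a p).eval b) :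
    ∃ v, HasSimpleZeros (-shiftedEulerOp a p) (N + 1) v ∧ ∀ i < N + 1, b < v i := by
  set s : ℕ → ℝ := fun i => if i = 0 then b else u (i - 1) with hs
  have hbs : ∀ i < N + 1, b ≤ s i := by
    intro i hi
    simp only [hs]
    split_ifs with h0
    · exact le_rfl
    · exact (hb _ (by omega)).le
  obtain ⟨hm, hd⟩ := monic_neg_shiftedEulerOp h.monic a
  obtain ⟨v, hv, hsv, -⟩ := exists_hasSimpleZeros (s := s) hm (hd.trans (by rw [h.natDegree]))
    (by
      intro i hi j hj hij
      simp only [Set.mem_Iio] at hi hj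
      simp only [hs, if_neg (show j ≠ 0 by omega)]
      split_ifs with h0
      · exact hb _ (by omega)
      · exact h.strictMonoOn (show i - 1 < N by omega) (show j - 1 < N by omega) (by omega))
    (by
      intro i hi
      rcases i with _ | i
      · simpa [hs] using hsign
      · have hi' : i < N := by omega
        have h1 := mul_pos (hu i hi') (h.derivative_sign hi')
        have e : N + 1 - (i + 1) = N - 1 - i + 1 := by omega
        have e2 : s (i + 1) = u i := by simp [hs]
        rw [e, e2, eval_neg_shiftedEulerOp, h.eval_zero hi', pow_succ]
        linarith)
  exact ⟨v, hv, fun i hi => (hbs i hi).trans_lt (hsv i hi)⟩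

/-- If `a > 0`, the sign of the image at `0` provides the additional sign change, and its zeros are
again positive. -/
theorem PosSimple.neg_shiftedEulerOp (h : PosSimple p N) {a : ℝ} (ha : 0 < a) :
    PosSimple (-shiftedEulerOp a p) (N + 1) := by
  obtain ⟨u, h, hu⟩ := h
  refine h.neg_shiftedEulerOp hu a 0 hu ?_
  have := h.eval_sign (k := 0) (x := 0) (by simp) fun i _ hi => hu i hi
  rw [eval_neg_shiftedEulerOp, pow_succ]
  have := mul_pos ha this
  simp only [Nat.sub_zero] at this
  linarith

/-- For arbitrary `a`, the additional sign change comes from the behaviour at `-∞`; the smallest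
zero of the image need not be positive. -/
theorem PosSimple.exists_hasSimpleZeros_neg_shiftedEulerOp (h : PosSimple p N) (a : ℝ) :
    ∃ v, HasSimpleZeros (-shiftedEulerOp a p) (N + 1) v := by
  obtain ⟨u, h, hu⟩ := h
  obtain ⟨hm, hd⟩ := monic_neg_shiftedEulerOp h.monic a
  rw [h.natDegree] at hd
  obtain ⟨b, hb, hsb⟩ := exists_lt_eval_sign hm (by omega) (min 0 (u 0))
  rw [hd] at hsb
  obtain ⟨v, hv, -⟩ := h.neg_shiftedEulerOp hu a b (fun i hi => by
    refine (hb.trans_le (min_le_right _ _)).trans_le ?_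
    exact h.strictMonoOn.monotoneOn (show 0 < N by omega) hi (Nat.zero_le i)) hsb
  exact ⟨v, hv⟩

theorem PosSimple.aeval_prod (h : PosSimple p N) {c : ℝ} (s : Multiset ℝ) (hs : ∀ r ∈ s, r < c) :
    PosSimple ((-1 : ℝ) ^ s.card •
      aeval (shiftedEulerOp c) (s.map fun r => X - C r).prod p) (N + s.card) := by
  induction s using Multiset.induction_on with
  | empty => simpa using h
  | cons r s ih =>
    have h1 := (ih fun r hr => hs r (Multiset.mem_cons_of_mem hr)).neg_shiftedEulerOp
      (sub_pos.2 (hs r (Multiset.mem_cons_self r s)))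
    rw [Multiset.card_cons, Multiset.map_cons, Multiset.prod_cons, map_mul, Module.End.mul_apply,
      aeval_shiftedEulerOp_X_sub_C]
    rw [← add_assoc]
    convert h1 using 1
    rw [map_smul, pow_succ, mul_neg_one, neg_smul]

end Step

/-! ### Laguerre polynomials and the raising operator -/

theorem coeff_monicLaguerre (α : ℝ) (n i : ℕ) : (monicLaguerre α n).coeff i =
    if i ≤ n then (-1) ^ n * (n.factorial : ℝ) * ((-1) ^ i / (i.factorial : ℝ) *
      ((ascPochhammer ℝ (n - i)).eval (α + i + 1) / ((n - i).factorial : ℝ))) else 0 := by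
  simp only [monicLaguerre, laguerre, coeff_C_mul, finsetSum_coeff, coeff_X_pow]
  simp

theorem monicLaguerre_zero (α : ℝ) : monicLaguerre α 0 = 1 := by
  simp [monicLaguerre, laguerre]

/-- The raising relation `L̂_{n+1} = -e^x (x d/dx + α + n + 1) e^{-x} L̂_n`. -/
theorem monicLaguerre_succ (α : ℝ) (n : ℕ) :
    monicLaguerre α (n + 1) = -shiftedEulerOp (α + n + 1) (monicLaguerre α n) := by
  have key : ∀ (d : ℕ) (y : ℝ), (ascPochhammer ℝ (d + 1)).eval y =
      y * (ascPochhammer ℝ d).eval (y + 1) := by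
    intro d y
    simp [ascPochhammer_succ_left]
  rw [shiftedEulerOp_apply]
  ext i
  rcases i with _ | i
  · simp only [coeff_neg, coeff_add, coeff_sub, mul_coeff_zero, coeff_X_zero, coeff_C_zero,
      coeff_monicLaguerre, ascPochhammer_succ_eval, Nat.zero_le, if_true, Nat.sub_zero,
      Nat.factorial_succ]
    have := Nat.factorial_ne_zero n
    push_cast
    field_simp
    ring
  · simp only [coeff_neg, coeff_add, coeff_sub, coeff_C_mul, coeff_X_mul, coeff_derivative,
      coeff_monicLaguerre]
    rcases lt_trichotomy i n with hi | rfl | hi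
    · obtain ⟨d, rfl⟩ : ∃ d, n = i + 1 + d := ⟨n - (i + 1), by omega⟩
      have e1 : i + 1 + d + 1 - (i + 1) = d + 1 := by omega
      have e2 : i + 1 + d - (i + 1) = d := by omega
      have e3 : i + 1 + d - i = d + 1 := by omega
      rw [if_pos (by omega), if_pos (by omega), if_pos (by omega), e1, e2, e3, key d (α + i + 1),
        ascPochhammer_succ_eval, Nat.factorial_succ d, Nat.factorial_succ i,
        Nat.factorial_succ (i + 1 + d)]
      have := Nat.factorial_ne_zero d
      have := Nat.factorial_ne_zero i
      push_cast
      rw [show α + i + 1 + 1 = α + (i + 1) + 1 by ring]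
      field_simp
      ring
    · simp [pow_succ]
      have := Nat.factorial_ne_zero i
      have : ((i + 1).factorial : ℝ) ≠ 0 := by positivity
      field_simp
    · rw [if_neg (by omega), if_neg (by omega), if_neg (by omega)]
      simp

theorem posSimple_monicLaguerre {α : ℝ} (hα : -1 < α) (n : ℕ) :
    PosSimple (monicLaguerre α n) n := by
  induction n with
  | zero =>
    rw [monicLaguerre_zero]
    exact ⟨fun _ => 0, ⟨by simp, fun i hi => absurd hi (by simp)⟩, by simp⟩
  | succ n ih =>
    rw [monicLaguerre_succ]
    exact ih.neg_shiftedEulerOp (by have := n.cast_nonneg (α := ℝ); linarith)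

theorem aeval_ascPochhammer (α : ℝ) (m s : ℕ) :
    aeval (shiftedEulerOp (α + m + 1)) (ascPochhammer ℝ s) (monicLaguerre α m) =
      (-1 : ℝ) ^ s • monicLaguerre α (m + s) := by
  induction s with
  | zero => simp
  | succ s ih =>
    rw [ascPochhammer_succ_right, mul_comm, map_mul, Module.End.mul_apply, ih,
      show ((s : ℝ[X])) = C (s : ℝ) by simp, aeval_shiftedEulerOp_X_add_C, map_smul, ← add_assoc,
      monicLaguerre_succ, pow_succ]
    push_cast
    rw [show α + m + 1 + s = α + (m + s) + 1 by ring]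
    simp

/-- The combination `q_{m+K}` is the image of `L̂_m` under the polynomial `(-1)^K Q` in the
operator `e^x ∘ (x d/dx + α + m + 1) ∘ e^{-x}`. -/
theorem q_eq_aeval (α : ℝ) (K : ℕ) (γ : ℕ → ℝ) (m : ℕ) : q α K γ (m + K) =
    (-1 : ℝ) ^ K • aeval (shiftedEulerOp (α + m + 1)) (Q K γ) (monicLaguerre α m) := by
  rw [Q, q, map_sum, LinearMap.sum_apply, Finset.smul_sum]
  refine Finset.sum_congr rfl fun j hj => ?_
  have hj : j ≤ K := Nat.lt_succ_iff.1 (Finset.mem_range.1 hj)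
  rw [map_mul, Module.End.mul_apply, aeval_ascPochhammer, aeval_C, Module.algebraMap_end_apply,
    smul_smul, smul_smul, ← Nat.add_sub_assoc hj, smul_eq_C_mul]
  congr 2
  obtain ⟨d, rfl⟩ := Nat.exists_eq_add_of_le hj
  rw [Nat.add_sub_cancel_left, pow_add, mul_comm _ (γ j)]
  calc γ j = γ j * (((-1) ^ j * (-1) ^ j) * ((-1) ^ d * (-1) ^ d)) := by simp [← mul_pow]
    _ = _ := by ring

/-- `x L̂_n' = n L̂_n + n (n + α) L̂_{n-1}`. -/
theorem X_mul_derivative_monicLaguerre (α : ℝ) (n : ℕ) :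
    X * derivative (monicLaguerre α (n + 1)) = C (n + 1 : ℝ) * monicLaguerre α (n + 1) +
      C ((n + 1) * (n + 1 + α)) * monicLaguerre α n := by
  induction n with
  | zero =>
    rw [monicLaguerre_succ, monicLaguerre_zero, shiftedEulerOp_apply]
    simp
    ring
  | succ n ih =>
    have h1 := monicLaguerre_succ α n
    have h2 := monicLaguerre_succ α (n + 1)
    rw [shiftedEulerOp_apply] at h1 h2
    have h3 := congrArg derivative ih
    have h4 := congrArg derivative h2
    simp only [derivative_mul, derivative_X, derivative_sub, derivative_neg,
      derivative_C, zero_mul, one_mul, zero_add, map_add, map_mul, map_one, map_natCast,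
      Nat.cast_add, Nat.cast_one, derivative_natCast, derivative_one, add_zero] at h1 h2 h3 h4 ih ⊢
    linear_combination X * h4 - ((n : ℝ[X]) + 2) * h2 - X * h3 + (X - (C α + n + 1)) * ih -
      ((n : ℝ[X]) + 1) * (n + 1 + C α) * h1

/-- The three-term recurrence of the monic Laguerre polynomials. -/
theorem eval_monicLaguerre_add_two (α : ℝ) (n : ℕ) (x : ℝ) :
    (monicLaguerre α (n + 2)).eval x = (x - (2 * n + 3 + α)) * (monicLaguerre α (n + 1)).eval x -
      (n + 1) * (n + 1 + α) * (monicLaguerre α n).eval x := by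
  have h1 := congrArg (eval x) (monicLaguerre_succ α (n + 1))
  have h2 := congrArg (eval x) (X_mul_derivative_monicLaguerre α n)
  rw [eval_neg_shiftedEulerOp] at h1
  simp only [eval_add, eval_mul, eval_X, eval_C] at h2
  push_cast at h1
  linear_combination h1 - h2

/-! ### Combinations of large index -/

theorem pos_of_abs_sub_lt {e a b : ℝ} (ha : 0 < e * a) (h : |b - a| < |a|) : 0 < e * b := by
  have h' := abs_lt.1 h
  rcases pos_and_pos_or_neg_and_neg_of_mul_pos ha with ⟨h1, h2⟩ | ⟨h1, h2⟩
  · rw [abs_of_pos h2] at h'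
    exact mul_pos h1 (by linarith)
  · rw [abs_of_neg h2] at h'
    exact mul_pos_of_neg_of_neg h1 (by linarith)

/-- Beyond `8 n` the values of the first `n` monic Laguerre polynomials grow by factors of at
least `n`. -/
theorem mul_eval_monicLaguerre_le {α : ℝ} (hα : -1 < α) {n : ℕ} (hαn : |α| ≤ n) {x : ℝ}
    (hx : 8 * (n : ℝ) ≤ x) {k : ℕ} (hk : k + 1 ≤ n) :
    0 < (monicLaguerre α k).eval x ∧
      n * (monicLaguerre α k).eval x ≤ (monicLaguerre α (k + 1)).eval x := by
  have hα2 := (abs_le.1 hαn).2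
  induction k with
  | zero =>
    have hn : (1 : ℝ) ≤ n := by exact_mod_cast hk
    have h1 : (monicLaguerre α (0 + 1)).eval x = x - (α + 1) := by
      rw [monicLaguerre_succ, monicLaguerre_zero, eval_neg_shiftedEulerOp]
      simp
    rw [h1, monicLaguerre_zero]
    simp only [eval_one]
    exact ⟨one_pos, by linarith⟩
  | succ k ih =>
    obtain ⟨h1, h2⟩ := ih (by omega)
    have hkn : (k : ℝ) + 1 + 1 ≤ n := by exact_mod_cast hk
    have hk0 : (0 : ℝ) ≤ k := k.cast_nonneg
    have hn : (0 : ℝ) < n := by linarith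
    have h3 : 0 < (monicLaguerre α (k + 1)).eval x := (mul_pos hn h1).trans_le h2
    refine ⟨h3, ?_⟩
    rw [eval_monicLaguerre_add_two]
    have h4 : ((k : ℝ) + 1) * (k + 1 + α) ≤ n * (2 * n) :=
      mul_le_mul (by linarith) (by linarith) (by linarith) hn.le
    have h5 := mul_le_mul_of_nonneg_right h4 h1.le
    have h6 : 5 * (n : ℝ) ≤ x - (2 * k + 3 + α) := by linarith
    have h7 := mul_le_mul_of_nonneg_right h6 h3.le
    have h8 := mul_le_mul_of_nonneg_left h2 (show (0 : ℝ) ≤ 2 * n by linarith)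
    have h9 := mul_pos hn h3
    linarith

/-- The lower Laguerre polynomials are controlled by two consecutive ones: by the recurrence read
backwards if `x ≤ 8 n`, and by the growth in the degree otherwise. -/
theorem pow_mul_abs_eval_monicLaguerre_le {α : ℝ} (hα : -1 < α) {K n : ℕ} (hn : 2 * K + 4 ≤ n)
    (hαn : |α| ≤ n) {x : ℝ} (hx : 0 ≤ x) {j : ℕ} (hj : j ≤ K) :
    (n : ℝ) ^ j * |(monicLaguerre α (n - j)).eval x| ≤
      72 ^ j * (|(monicLaguerre α n).eval x| + n * |(monicLaguerre α (n - 1)).eval x|) := by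
  have hα2 := (abs_le.1 hαn).2
  have hnR : 2 * (K : ℝ) + 4 ≤ n := by exact_mod_cast hn
  have hK0 : (0 : ℝ) ≤ K := K.cast_nonneg
  have hn0 : (0 : ℝ) < n := by linarith
  set H := |(monicLaguerre α n).eval x| + n * |(monicLaguerre α (n - 1)).eval x| with hH
  have hH1 : |(monicLaguerre α n).eval x| ≤ H := le_add_of_nonneg_right (by positivity)
  have hH2 : n * |(monicLaguerre α (n - 1)).eval x| ≤ H := le_add_of_nonneg_left (by positivity)
  have hH0 : 0 ≤ H := (abs_nonneg _).trans hH1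
  rcases le_total x (8 * n) with hx8 | hx8
  · have key : ∀ j, j + 1 ≤ K →
        (n : ℝ) ^ j * |(monicLaguerre α (n - j)).eval x| ≤ 72 ^ j * H ∧
        (n : ℝ) ^ (j + 1) * |(monicLaguerre α (n - (j + 1))).eval x| ≤ 72 ^ (j + 1) * H := by
      intro j
      induction j with
      | zero =>
        intro _
        refine ⟨by simpa using hH1, ?_⟩
        simp only [zero_add, pow_one]
        linarith
      | succ j ih =>
        intro hj
        obtain ⟨h1, h2⟩ := ih (by omega)
        refine ⟨h2, ?_⟩
        obtain ⟨k, rfl⟩ : ∃ k, n = k + 2 + j := ⟨n - 2 - j, by omega⟩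
        rw [show k + 2 + j - j = k + 2 by omega] at h1
        rw [show k + 2 + j - (j + 1) = k + 1 by omega] at h2
        rw [show k + 2 + j - (j + 1 + 1) = k by omega]
        have hjR : (j : ℝ) + 2 ≤ K := by exact_mod_cast hj
        have hrec := eval_monicLaguerre_add_two α k x
        set a := (monicLaguerre α k).eval x
        set b := (monicLaguerre α (k + 1)).eval x
        set c := (monicLaguerre α (k + 2)).eval x
        have hk0 : (0 : ℝ) ≤ k := k.cast_nonneg
        have hj0 : (0 : ℝ) ≤ j := j.cast_nonneg
        set ν : ℝ := ((k + 2 + j : ℕ) : ℝ) with hν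
        have hν' : ν = k + 2 + j := by rw [hν]; push_cast; ring
        have hlow : ν / 2 * (ν / 4) ≤ ((k : ℝ) + 1) * (k + 1 + α) :=
          mul_le_mul (by linarith) (by linarith) (by linarith) (by linarith)
        have hx' : |x - (2 * k + 3 + α)| ≤ 8 * ν := abs_le.2 ⟨by linarith, by linarith⟩
        have h3 : ((k : ℝ) + 1) * (k + 1 + α) * |a| ≤ 8 * ν * |b| + |c| := by
          calc ((k : ℝ) + 1) * (k + 1 + α) * |a| = |(x - (2 * k + 3 + α)) * b - c| := by
                rw [hrec, sub_sub_cancel, abs_mul,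
                  abs_of_nonneg (mul_nonneg (by linarith) (by linarith : 0 ≤ (k : ℝ) + 1 + α))]
            _ ≤ |(x - (2 * k + 3 + α)) * b| + |c| := abs_sub _ _
            _ ≤ _ := by
                rw [abs_mul]
                gcongr
        have h4 : ν ^ 2 * |a| ≤ 64 * (ν * |b|) + 8 * |c| := by
          have := mul_le_mul_of_nonneg_right hlow (abs_nonneg a)
          nlinarith
        calc ν ^ (j + 1 + 1) * |a| = ν ^ j * (ν ^ 2 * |a|) := by ring
          _ ≤ ν ^ j * (64 * (ν * |b|) + 8 * |c|) := by gcongr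
          _ = 64 * (ν ^ (j + 1) * |b|) + 8 * (ν ^ j * |c|) := by ring
          _ ≤ 64 * (72 ^ (j + 1) * H) + 8 * (72 ^ j * H) := by gcongr
          _ ≤ 72 ^ (j + 1 + 1) * H := by
            have : 0 ≤ (72 : ℝ) ^ j * H := by positivity
            rw [show (72 : ℝ) ^ (j + 1 + 1) * H = 5184 * (72 ^ j * H) by ring,
              show (72 : ℝ) ^ (j + 1) * H = 72 * (72 ^ j * H) by ring]
            linarith only [this]
    rcases j with _ | j
    · simpa using hH1
    · exact (key j hj).2
  · have key : ∀ j, j ≤ K → (n : ℝ) ^ j * (monicLaguerre α (n - j)).eval x ≤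
        (monicLaguerre α n).eval x := by
      intro j
      induction j with
      | zero => simp
      | succ j ih =>
        intro hj
        refine le_trans ?_ (ih (by omega))
        have h1 := (mul_eval_monicLaguerre_le hα hαn hx8 (k := n - (j + 1)) (by omega)).2
        rw [show n - (j + 1) + 1 = n - j by omega] at h1
        rw [pow_succ, mul_assoc]
        gcongr
    rcases j with _ | j
    · simpa using hH1
    rw [abs_of_pos (mul_eval_monicLaguerre_le hα hαn hx8 (k := n - (j + 1)) (by omega)).1]
    calc _ ≤ _ := key _ hj
      _ ≤ H := (le_abs_self _).trans hH1
      _ ≤ _ := le_mul_of_one_le_left hH0 (one_le_pow₀ (by norm_num))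

/-- The constant in the comparison of `q_n` with `L̂_n`; the powers of `72` come from the backward
recurrence. -/
noncomputable def tailWeight (K : ℕ) (γ : ℕ → ℝ) : ℝ :=
  ∑ j ∈ Finset.range (K + 1), |γ j| * 72 ^ j

theorem tailWeight_nonneg (K : ℕ) (γ : ℕ → ℝ) : 0 ≤ tailWeight K γ :=
  Finset.sum_nonneg fun _ _ => by positivity

/-- The index `n` is so large that `L̂_n` dominates the combination `q_n`. -/
structure IsLargeIndex (α : ℝ) (K : ℕ) (γ : ℕ → ℝ) (n : ℕ) : Prop where
  degree : 2 * K + 4 ≤ n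
  parameter : |α| ≤ n
  weight : 100 * (tailWeight K γ + 1) ≤ n

theorem exists_isLargeIndex (α : ℝ) (K : ℕ) (γ : ℕ → ℝ) :
    ∃ N, K ≤ N ∧ ∀ n, N ≤ n → IsLargeIndex α K γ n := by
  refine ⟨2 * K + 4 + ⌈|α|⌉₊ + ⌈100 * (tailWeight K γ + 1)⌉₊, by omega, fun n hn => ⟨by omega, ?_, ?_⟩⟩
  · exact (Nat.le_ceil _).trans (by exact_mod_cast (show ⌈|α|⌉₊ ≤ n by omega))
  · refine (Nat.le_ceil _).trans ?_
    exact_mod_cast (show ⌈100 * (tailWeight K γ + 1)⌉₊ ≤ n by omega)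

section Large

variable {α : ℝ} {K n : ℕ} {γ : ℕ → ℝ}

theorem IsLargeIndex.abs_sub_le (h : IsLargeIndex α K γ n) (hα : -1 < α) (hγ : γ 0 = 1) {x : ℝ}
    (hx : 0 ≤ x) : n * |(q α K γ n).eval x - (monicLaguerre α n).eval x| ≤
      tailWeight K γ *
        (|(monicLaguerre α n).eval x| + n * |(monicLaguerre α (n - 1)).eval x|) := by
  set H := |(monicLaguerre α n).eval x| + n * |(monicLaguerre α (n - 1)).eval x| with hH
  have hH0 : 0 ≤ H := by positivity
  have hn1 : (1 : ℝ) ≤ n := by exact_mod_cast (show 1 ≤ n by have := h.degree; omega)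
  have hsub : (q α K γ n).eval x - (monicLaguerre α n).eval x =
      ∑ j ∈ Finset.range K, γ (j + 1) * (monicLaguerre α (n - (j + 1))).eval x := by
    simp [q, Finset.sum_range_succ', eval_finsetSum, hγ]
  rw [hsub, tailWeight, Finset.sum_range_succ', add_mul, Finset.sum_mul]
  refine le_trans ?_ (le_add_of_nonneg_right (by positivity))
  refine (mul_le_mul_of_nonneg_left (Finset.abs_sum_le_sum_abs _ _) n.cast_nonneg).trans ?_
  rw [Finset.mul_sum]
  refine Finset.sum_le_sum fun j hj => ?_
  have hb := pow_mul_abs_eval_monicLaguerre_le hα h.degree h.parameter hx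
    (Nat.succ_le_of_lt (Finset.mem_range.1 hj))
  have hp : (n : ℝ) ≤ n ^ (j + 1) := le_self_pow₀ hn1 (Nat.succ_ne_zero j)
  rw [abs_mul]
  calc (n : ℝ) * (|γ (j + 1)| * |(monicLaguerre α (n - (j + 1))).eval x|) =
        |γ (j + 1)| * (n * |(monicLaguerre α (n - (j + 1))).eval x|) := by ring
    _ ≤ |γ (j + 1)| * (n ^ (j + 1) * |(monicLaguerre α (n - (j + 1))).eval x|) := by gcongr
    _ ≤ |γ (j + 1)| * (72 ^ (j + 1) * H) := by gcongr
    _ = _ := by ring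

theorem monic_q (hα : -1 < α) (hγ : γ 0 = 1) (hKn : K ≤ n) :
    (q α K γ n).Monic ∧ (q α K γ n).natDegree = n := by
  have hL : ∀ k, (monicLaguerre α k).Monic ∧ (monicLaguerre α k).natDegree = k := by
    intro k
    obtain ⟨u, hu, -⟩ := posSimple_monicLaguerre hα k
    exact ⟨hu.monic, hu.natDegree⟩
  have hlt : (∑ j ∈ Finset.range K, C (γ (j + 1)) * monicLaguerre α (n - (j + 1))).degree <
      (monicLaguerre α n).degree := by
    rw [degree_eq_natDegree (hL n).1.ne_zero, (hL n).2]
    refine (degree_sum_le _ _).trans_lt ((Finset.sup_lt_iff (WithBot.bot_lt_coe _)).2 ?_)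
    intro j hj
    have := Finset.mem_range.1 hj
    rw [← smul_eq_C_mul]
    refine (degree_smul_le _ _).trans_lt ?_
    rw [degree_eq_natDegree (hL _).1.ne_zero, (hL _).2]
    exact_mod_cast (show n - (j + 1) < n by omega)
  have hq : q α K γ n = monicLaguerre α n +
      ∑ j ∈ Finset.range K, C (γ (j + 1)) * monicLaguerre α (n - (j + 1)) := by
    simp [q, Finset.sum_range_succ', hγ, add_comm]
  rw [hq]
  exact ⟨(hL n).1.add_of_left hlt, by
    rw [natDegree_eq_of_degree_eq (degree_add_eq_left_of_degree_lt hlt), (hL n).2]⟩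

/-- For large `n` the values of `q_n` at `0` and at the zeros of `L̂_{n-1}` have the signs of those
of `L̂_n`, so that the zeros of `L̂_{n-1}` separate the zeros of `q_n`. -/
theorem IsLargeIndex.exists_zeros (h : IsLargeIndex α K γ n) (hα : -1 < α) (hγ : γ 0 = 1) :
    ∃ w v, HasSimpleZeros (q α K γ n) n w ∧ HasSimpleZeros (monicLaguerre α (n - 1)) (n - 1) v ∧
      (∀ i < n, 0 < w i) ∧ ∀ i < n - 1, w i < v i ∧ v i < w (i + 1) := by
  obtain ⟨m, rfl⟩ : ∃ m, n = m + 1 := ⟨n - 1, by have := h.degree; omega⟩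
  simp only [Nat.add_sub_cancel]
  obtain ⟨v, hv, hv0⟩ := posSimple_monicLaguerre hα m
  have hC0 := tailWeight_nonneg K γ
  have hC := h.weight
  have hm0 : (0 : ℝ) ≤ m := m.cast_nonneg
  set s : ℕ → ℝ := fun i => if i = 0 then 0 else v (i - 1) with hs
  have hs1 : ∀ i, s (i + 1) = v i := fun i => by simp [hs]
  have hs0 : ∀ i < m + 1, 0 ≤ s i := by
    rintro (_ | i) hi
    · simp [hs]
    · rw [hs1]
      exact (hv0 i (by omega)).le
  obtain ⟨hmon, hdeg⟩ := monic_q (K := K) (n := m + 1) hα hγ (by have := h.degree; omega)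
  obtain ⟨w, hw, hsw, hws⟩ := exists_hasSimpleZeros (s := s) hmon hdeg
    (by
      intro i hi j hj hij
      simp only [Set.mem_Iio] at hi hj
      obtain ⟨j, rfl⟩ : ∃ k, j = k + 1 := ⟨j - 1, by omega⟩
      rw [hs1]
      rcases i with _ | i
      · simpa [hs] using hv0 j (by omega)
      · rw [hs1]
        exact hv.strictMonoOn (show i < m by omega) (show j < m by omega) (by omega))
    (by
      intro i hi
      have hle := h.abs_sub_le hα hγ (hs0 i hi)
      rcases i with _ | i
      · have e0 : s 0 = 0 := by simp [hs]
        rw [e0] at hle ⊢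
        simp only [Nat.add_sub_cancel] at hle
        have hLm := hv.eval_sign (k := 0) (x := 0) (by simp) fun i _ hi => hv0 i hi
        rw [Nat.sub_zero] at hLm
        have hL : (monicLaguerre α (m + 1)).eval 0 = -(α + m + 1) * (monicLaguerre α m).eval 0 := by
          rw [monicLaguerre_succ, eval_neg_shiftedEulerOp]
          ring
        have hpos : 0 < (-1) ^ (m + 1 - 0) * (monicLaguerre α (m + 1)).eval 0 := by
          have := mul_pos (show 0 < α + m + 1 by linarith) hLm
          rw [hL, Nat.sub_zero, pow_succ]
          linarith
        refine pos_of_abs_sub_lt hpos ?_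
        have habs : |(monicLaguerre α (m + 1)).eval 0| =
            (α + m + 1) * |(monicLaguerre α m).eval 0| := by
          rw [hL, abs_mul, abs_neg, abs_of_pos (by linarith : 0 < α + m + 1)]
        have hP : 0 < |(monicLaguerre α (m + 1)).eval 0| := abs_pos.2 (by
          intro h0
          rw [h0, mul_zero] at hpos
          exact lt_irrefl _ hpos)
        set P := |(monicLaguerre α (m + 1)).eval 0|
        set R := |(monicLaguerre α m).eval 0| with hR
        have hR0 : 0 ≤ R := abs_nonneg _
        push_cast at hle hC
        have h1 : ((m : ℝ) + 1) * R ≤ 2 * P := by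
          rw [habs]
          have := mul_le_mul_of_nonneg_right
            (show (m : ℝ) + 1 ≤ 2 * (α + m + 1) by linarith) hR0
          linarith
        have h2 : tailWeight K γ * (P + (m + 1) * R) ≤ tailWeight K γ * (3 * P) :=
          mul_le_mul_of_nonneg_left (by linarith) hC0
        have h3 : tailWeight K γ * (3 * P) < (m + 1) * P := by
          have := mul_lt_mul_of_pos_right (show tailWeight K γ * 3 < m + 1 by linarith) hP
          linarith
        exact lt_of_mul_lt_mul_left ((hle.trans h2).trans_lt h3) (by linarith)
      · have hi' : i < m := by omega
        rw [hs1] at hle ⊢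
        simp only [Nat.add_sub_cancel, hv.eval_zero hi', abs_zero, mul_zero, add_zero] at hle
        have hpos : 0 < (-1) ^ (m + 1 - (i + 1)) * (monicLaguerre α (m + 1)).eval (v i) := by
          have h1 := mul_pos (hv0 i hi') (hv.derivative_sign hi')
          have e : m + 1 - (i + 1) = m - 1 - i + 1 := by omega
          rw [e, monicLaguerre_succ, eval_neg_shiftedEulerOp, hv.eval_zero hi', pow_succ]
          linarith
        refine pos_of_abs_sub_lt hpos ?_
        have hP : 0 < |(monicLaguerre α (m + 1)).eval (v i)| := abs_pos.2 (by
          intro h0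
          rw [h0, mul_zero] at hpos
          exact lt_irrefl _ hpos)
        push_cast at hle hC
        exact lt_of_mul_lt_mul_left
          (hle.trans_lt (mul_lt_mul_of_pos_right (show tailWeight K γ < m + 1 by linarith) hP))
          (by linarith))
  refine ⟨w, v, hw, hv, fun i hi => (hs0 i hi).trans_lt (hsw i hi), fun i hi => ⟨?_, ?_⟩⟩
  · rw [← hs1]
    exact hws i (by omega)
  · rw [← hs1]
    exact hsw (i + 1) (by omega)

/-- For large `n` the sign of `q_{n+1}` at a zero of `q_n` is opposite to that of `L̂_{n-1}`: there
`L̂_n` is of the order of `L̂_{n-1}`, and by the recurrence the main term of `q_{n+1}` is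
`-n (n + α) L̂_{n-1}`. -/
theorem IsLargeIndex.sign_succ (h : IsLargeIndex α K γ n) (hα : -1 < α) (hγ : γ 0 = 1) {y : ℝ}
    (hy : 0 ≤ y) (hq : (q α K γ n).eval y = 0) {e : ℝ}
    (hR : 0 < e * (monicLaguerre α (n - 1)).eval y) : 0 < -e * (q α K γ (n + 1)).eval y := by
  have hsucc : IsLargeIndex α K γ (n + 1) := by
    refine ⟨h.degree.trans n.le_succ, ?_, ?_⟩
    · push_cast
      linarith [h.parameter]
    · push_cast
      linarith [h.weight]
  have h1 := h.abs_sub_le hα hγ hy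
  have h2 := hsucc.abs_sub_le hα hγ hy
  have hC0 := tailWeight_nonneg K γ
  have hC := h.weight
  have hα2 := (abs_le.1 h.parameter).2
  have hn4 : (4 : ℝ) ≤ n := by exact_mod_cast (show 4 ≤ n by have := h.degree; omega)
  have hy8 : y ≤ 8 * n := by
    by_contra hlt
    have hgrow := mul_eval_monicLaguerre_le hα h.parameter (not_le.1 hlt).le (k := n - 1)
      (by have := h.degree; omega)
    rw [show n - 1 + 1 = n by have := h.degree; omega] at hgrow
    have hP : 0 < (monicLaguerre α n).eval y := (mul_pos (by linarith) hgrow.1).trans_le hgrow.2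
    rw [hq, zero_sub, abs_neg, abs_of_pos hP, abs_of_pos hgrow.1] at h1
    have h3 := mul_le_mul_of_nonneg_left hgrow.2 hC0
    have h4 := mul_lt_mul_of_pos_right (show tailWeight K γ * 2 < n by linarith) hP
    linarith
  obtain ⟨m, rfl⟩ : ∃ m, n = m + 1 := ⟨n - 1, by have := h.degree; omega⟩
  simp only [Nat.add_sub_cancel] at h1 h2 hR
  have hrec := eval_monicLaguerre_add_two α m y
  rw [show m + 1 + 1 = m + 2 from rfl] at h2 ⊢
  rw [hq, zero_sub, abs_neg] at h1
  set R := (monicLaguerre α m).eval y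
  set P := (monicLaguerre α (m + 1)).eval y
  set S := (monicLaguerre α (m + 2)).eval y
  set A := tailWeight K γ
  have hR0 : 0 < |R| := abs_pos.2 (by
    intro h0
    rw [h0, mul_zero] at hR
    exact lt_irrefl _ hR)
  set ν : ℝ := ((m + 1 : ℕ) : ℝ) with hν
  have hν' : ν = m + 1 := by rw [hν]; push_cast; ring
  have hν2 : ((m + 2 : ℕ) : ℝ) = ν + 1 := by rw [hν']; push_cast; ring
  rw [hν2] at h2
  have hν0 : 0 < ν := by linarith
  have hPR : |P| ≤ 2 * A * |R| := by
    have h3 := mul_le_mul_of_nonneg_right (show A ≤ ν / 2 by linarith) (abs_nonneg P)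
    have h4 : ν * |P| ≤ ν * (2 * A * |R|) := by linarith
    exact le_of_mul_le_mul_left h4 hν0
  have hlow : ν * (ν / 2) ≤ ν * (ν + α) := by
    gcongr
    linarith
  have hup : ν * (ν + α) ≤ ν * (2 * ν) := by
    gcongr
    linarith
  rw [← hν'] at hrec
  have hyb : |y - (2 * m + 3 + α)| ≤ 8 * ν := abs_le.2 ⟨by linarith, by linarith⟩
  have hbP : |(y - (2 * m + 3 + α)) * P| ≤ 16 * ν * A * |R| := by
    rw [abs_mul]
    calc _ ≤ 8 * ν * (2 * A * |R|) := by gcongr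
      _ = _ := by ring
  have hmain : |ν * (ν + α) * R| = ν * (ν + α) * |R| := by
    rw [abs_mul, abs_of_nonneg ((by positivity : (0 : ℝ) ≤ ν * (ν / 2)).trans hlow)]
  have hS : |S| ≤ 16 * ν * A * |R| + 2 * ν * ν * |R| := by
    rw [hrec]
    refine (abs_sub _ _).trans (add_le_add hbP ?_)
    rw [hmain]
    have := mul_le_mul_of_nonneg_right hup hR0.le
    linarith
  have hqS : |(q α K γ (m + 2)).eval y - S| ≤ (18 * A * A + 2 * ν * A) * |R| := by
    have h3 : A * (|S| + (ν + 1) * |P|) ≤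
        A * (16 * ν * A * |R| + 2 * ν * ν * |R| + (ν + 1) * (2 * A * |R|)) := by gcongr
    have h4 : A * (16 * ν * A * |R| + 2 * ν * ν * |R| + (ν + 1) * (2 * A * |R|)) ≤
        (ν + 1) * ((18 * A * A + 2 * ν * A) * |R|) := by
      have : 0 ≤ (16 * A * A + 2 * ν * A) * |R| := by positivity
      linarith
    exact le_of_mul_le_mul_left ((h2.trans h3).trans h4) (by linarith)
  refine pos_of_abs_sub_lt (a := -(ν * (ν + α) * R)) ?_ ?_
  · have : 0 < ν * (ν + α) := (by positivity : (0 : ℝ) < ν * (ν / 2)).trans_le hlow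
    have := mul_pos this hR
    linarith
  · rw [abs_neg, hmain]
    have h5 : (q α K γ (m + 2)).eval y - -(ν * (ν + α) * R) =
        ((q α K γ (m + 2)).eval y - S) + (y - (2 * m + 3 + α)) * P := by
      rw [hrec]
      ring
    rw [h5]
    have h6 : 18 * A * A + 2 * ν * A + 16 * ν * A < ν * (ν / 2) := by
      have : A ≤ ν / 100 := by linarith
      have h7 : A * A ≤ ν / 100 * (ν / 100) := by gcongr
      have h8 : ν * A ≤ ν * (ν / 100) := by gcongr
      have h9 : 0 < ν * ν := by positivity
      linarith
    have h7 := mul_lt_mul_of_pos_right (h6.trans_le hlow) hR0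
    have h8 := (abs_add_le _ _).trans (add_le_add hqS hbP)
    linarith

end Large

/-! ### Interlacing -/

theorem HasSimpleZeros.interlaces {p p' : ℝ[X]} {N : ℕ} {u w : ℕ → ℝ}
    (hu : HasSimpleZeros p' (N + 1) u) (hw : HasSimpleZeros p N w)
    (h : ∀ i < N, u i < w i ∧ w i < u (i + 1)) :
    Interlaces p'.roots.toFinset p.roots.toFinset := by
  rw [hu.roots_eq, hw.roots_eq]
  have hle : ∀ i j, i ≤ j → j < N → u i < w j := fun i j hij hj =>
    (hu.strictMonoOn.monotoneOn (show i < N + 1 by omega) (show j < N + 1 by omega) hij).trans_lt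
      (h j hj).1
  have hlt : ∀ i j, i < j → j < N + 1 → w i < u j := fun i j hij hj =>
    (h i (by omega)).2.trans_le
      (hu.strictMonoOn.monotoneOn (show i + 1 < N + 1 by omega) (show j < N + 1 by omega) hij)
  have hdisj : (Finset.range (N + 1)).image u ∩ (Finset.range N).image w = ∅ := by
    rw [← Finset.disjoint_iff_inter_eq_empty, Finset.disjoint_left]
    simp only [Finset.mem_image, Finset.mem_range]
    rintro _ ⟨i, hi, rfl⟩ ⟨j, hj, hji⟩
    rcases le_or_gt i j with hij | hij
    · exact (hle i j hij hj).ne hji.symm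
    · exact (hlt j i hij hi).ne hji
  rw [Interlaces, hdisj, Finset.sdiff_empty, Finset.sdiff_empty]
  simp only [StrictlyInterlaces, Consecutive, Finset.mem_image, Finset.mem_range]
  refine ⟨⟨u 0, ⟨0, by omega, rfl⟩, ?_⟩, ?_, ?_⟩
  · rintro _ ⟨j, hj, rfl⟩
    exact hle 0 j (Nat.zero_le j) hj
  · rintro _ _ ⟨⟨i, hi, rfl⟩, ⟨j, hj, rfl⟩, hij, -⟩
    have hij' : i < j := (hu.strictMonoOn.lt_iff_lt hi hj).1 hij
    exact ⟨w i, ⟨i, by omega, rfl⟩, (h i (by omega)).1, hlt i j hij' hj⟩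
  · rintro _ _ ⟨⟨i, hi, rfl⟩, ⟨j, hj, rfl⟩, hij, -⟩
    have hij' : i < j := (hw.strictMonoOn.lt_iff_lt hi hj).1 hij
    exact ⟨u (i + 1), ⟨i + 1, by omega, rfl⟩, (h i hi).2, hle (i + 1) j hij' hj⟩

theorem IsLargeIndex.interlaces {α : ℝ} {K n : ℕ} {γ : ℕ → ℝ} (h : IsLargeIndex α K γ n)
    (h' : IsLargeIndex α K γ (n + 1)) (hα : -1 < α) (hγ : γ 0 = 1) :
    Interlaces (q α K γ (n + 1)).roots.toFinset (q α K γ n).roots.toFinset := by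
  obtain ⟨w, v, hw, hv, hw0, hwv⟩ := h.exists_zeros hα hγ
  obtain ⟨w', -, hw', -, hw'0, -⟩ := h'.exists_zeros hα hγ
  set s : ℕ → ℝ := fun i => if i = 0 then 0 else w (i - 1) with hs
  have hs1 : ∀ i, s (i + 1) = w i := fun i => by simp [hs]
  obtain ⟨u, hu, hsu, hus⟩ := exists_hasSimpleZeros (s := s) hw'.monic hw'.natDegree
    (by
      intro i hi j hj hij
      simp only [Set.mem_Iio] at hi hj
      obtain ⟨j, rfl⟩ : ∃ k, j = k + 1 := ⟨j - 1, by omega⟩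
      rw [hs1]
      rcases i with _ | i
      · simpa [hs] using hw0 j (by omega)
      · rw [hs1]
        exact hw.strictMonoOn (show i < n by omega) (show j < n by omega) (by omega))
    (by
      rintro (_ | i) hi
      · have e0 : s 0 = 0 := by simp [hs]
        rw [e0]
        exact hw'.eval_sign (by simp) fun i _ hi => hw'0 i hi
      · have hi' : i < n := by omega
        rw [hs1]
        have hR := hv.eval_sign (k := i) (x := w i)
          (fun j hj => (hwv j (by omega)).2.trans_le (hw.strictMonoOn.monotoneOn
            (show j + 1 < n by omega) hi' (by omega)))
          (fun j hij hj => (hw.strictMonoOn.monotoneOn hi' (show j < n by omega) hij).trans_lt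
            (hwv j hj).1)
        have := h.sign_succ hα hγ (hw0 i hi').le (hw.eval_zero hi') hR
        have e : n + 1 - (i + 1) = n - 1 - i + 1 := by omega
        rw [e, pow_succ, mul_neg_one]
        exact this)
  refine hu.interlaces hw fun i hi => ⟨?_, ?_⟩
  · rw [← hs1]
    exact hus i (by omega)
  · rw [← hs1]
    exact hsu (i + 1) (by omega)

/-! ### Expansion in rising factorials -/

theorem coeff_ascPochhammer_self (s : ℕ) : (ascPochhammer ℝ s).coeff s = 1 := by
  have := (monic_ascPochhammer ℝ s).coeff_natDegree
  rwa [ascPochhammer_natDegree] at this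

theorem Q_succ (K : ℕ) (γ : ℕ → ℝ) :
    Q (K + 1) γ = C (γ 0) * ascPochhammer ℝ (K + 1) - Q K fun j => γ (j + 1) := by
  rw [Q, Finset.sum_range_succ', Q, sub_eq_neg_add, ← Finset.sum_neg_distrib]
  congr 1
  · refine Finset.sum_congr rfl fun j _ => ?_
    rw [Nat.add_sub_add_right, pow_succ]
    simp
  · simp

/-- The rising factorials form a basis: every polynomial of degree at most `K` is some `Q`. -/
theorem exists_eq_Q {K : ℕ} {R : ℝ[X]} (hR : R.natDegree ≤ K) :
    ∃ γ : ℕ → ℝ, γ 0 = R.coeff K ∧ R = Q K γ := by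
  induction K generalizing R with
  | zero =>
    refine ⟨fun _ => R.coeff 0, rfl, ?_⟩
    simpa [Q] using eq_C_of_natDegree_le_zero hR
  | succ K ih =>
    have hdeg : (C (R.coeff (K + 1)) * ascPochhammer ℝ (K + 1) - R).natDegree ≤ K := by
      refine natDegree_le_pred (n := K + 1) ?_ ?_
      · refine (natDegree_sub_le _ _).trans (max_le ((natDegree_C_mul_le _ _).trans ?_) hR)
        rw [ascPochhammer_natDegree]
      · rw [coeff_sub, coeff_C_mul, coeff_ascPochhammer_self, mul_one, sub_self]
    obtain ⟨γ, -, hγ⟩ := ih hdeg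
    refine ⟨fun j => Nat.casesOn j (R.coeff (K + 1)) γ, rfl, ?_⟩
    rw [Q_succ]
    change R = C (R.coeff (K + 1)) * ascPochhammer ℝ (K + 1) - Q K γ
    rw [← hγ, sub_sub_cancel]

theorem natDegree_Q_le (K : ℕ) (γ : ℕ → ℝ) : (Q K γ).natDegree ≤ K := by
  refine natDegree_sum_le_of_forall_le _ _ fun j _ => (natDegree_C_mul_le _ _).trans ?_
  rw [ascPochhammer_natDegree]
  omega

theorem monic_Q {K : ℕ} {γ : ℕ → ℝ} (hγ : γ 0 = 1) : (Q K γ).Monic := by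
  refine monic_of_natDegree_le_of_coeff_eq_one K (natDegree_Q_le K γ) ?_
  rcases K with _ | K
  · simp [Q, hγ]
  · rw [Q_succ, hγ, C_1, one_mul, coeff_sub, coeff_ascPochhammer_self,
      coeff_eq_zero_of_natDegree_lt (Nat.lt_succ_of_le (natDegree_Q_le K _)), sub_zero]

theorem natDegree_Q {K : ℕ} {γ : ℕ → ℝ} (hγ : γ 0 = 1) : (Q K γ).natDegree = K := by
  refine (natDegree_Q_le K γ).antisymm (le_natDegree_of_ne_zero ?_)
  rcases K with _ | K
  · simp [Q, hγ]
  · rw [Q_succ, hγ, C_1, one_mul, coeff_sub, coeff_ascPochhammer_self,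
      coeff_eq_zero_of_natDegree_lt (Nat.lt_succ_of_le (natDegree_Q_le K _)), sub_zero]
    exact one_ne_zero

/-! ### Combinations with real-rooted `Q` -/

theorem eq_prod_roots_of_onlyRealZeros {p : ℝ[X]} (hp : p.Monic) (h : OnlyRealZeros p) :
    p = (p.roots.map fun r => X - C r).prod := by
  refine (Splits.of_splits_map (algebraMap ℝ ℂ) (IsAlgClosed.splits _) ?_).eq_prod_roots_of_monic hp
  intro z hz
  have hz' : aeval z p = 0 := by
    rw [aeval_def, ← eval_map]
    exact (mem_roots'.1 hz).2
  exact ⟨z.re, Complex.ext (by simp) (by simp [h z hz'])⟩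

theorem card_roots_Q {K : ℕ} {γ : ℕ → ℝ} (hγ : γ 0 = 1) (hQ : OnlyRealZeros (Q K γ)) :
    (Q K γ).roots.card = K := by
  have := congrArg natDegree (eq_prod_roots_of_onlyRealZeros (monic_Q hγ) hQ)
  rwa [natDegree_Q hγ, natDegree_multiset_prod_X_sub_C_eq_card, eq_comm] at this

theorem le_threshold (α : ℝ) (K : ℕ) (γ : ℕ → ℝ) (l : ℕ) : K ≤ threshold α K γ l := by
  rw [threshold]
  generalize List.map _ _ = L
  induction L with
  | nil => exact le_rfl
  | cons a L ih => exact ih.trans (le_max_right _ _)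

theorem lt_of_threshold_le {α : ℝ} {K : ℕ} {γ : ℕ → ℝ} {l n : ℕ} (hn : threshold α K γ l ≤ n)
    {θ : ℝ} (hθ : θ ∈ (largeZeros α (Q K γ)).take ((largeZeros α (Q K γ)).length - l)) :
    θ < α + n - K + 1 := by
  have key : ∀ L : List ℕ, ∀ a ∈ L, a ≤ L.foldr max K := by
    intro L
    induction L with
    | nil => simp
    | cons b L ih =>
      intro a ha
      rcases List.mem_cons.1 ha with rfl | ha
      · exact le_max_left _ _
      · exact (ih a ha).trans (le_max_right _ _)
  have h1 := (key _ _ (List.mem_map_of_mem (f := fun θ => ⌊θ - α + K⌋₊) hθ)).trans hn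
  have h2 := Nat.lt_floor_add_one (θ - α + K)
  have h3 : ((⌊θ - α + K⌋₊ : ℕ) : ℝ) ≤ n := by exact_mod_cast h1
  linarith

theorem coe_largeZeros (α : ℝ) (p : ℝ[X]) :
    (largeZeros α p : Multiset ℝ) = p.roots.filter fun x => α + 1 ≤ x :=
  Multiset.sort_eq _ _

/-- All the factors `x d/dx + α + n - K + 1 - θ` in the factorization of `q_n` have a positive
constant, so that each of them preserves the positivity and simplicity of the zeros. -/
theorem posSimple_q_of_onlyRealZeros {α : ℝ} (hα : -1 < α) {K : ℕ} {γ : ℕ → ℝ} (hγ : γ 0 = 1)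
    (hQ : OnlyRealZeros (Q K γ)) {n : ℕ} (hn : threshold α K γ 0 ≤ n) :
    PosSimple (q α K γ n) n := by
  obtain ⟨m, rfl⟩ : ∃ m, n = m + K := ⟨n - K, by have := le_threshold α K γ 0; omega⟩
  have hprod := eq_prod_roots_of_onlyRealZeros (monic_Q hγ) hQ
  have hcard := card_roots_Q hγ hQ
  have h := (posSimple_monicLaguerre hα m).aeval_prod (c := α + m + 1) (Q K γ).roots (by
    intro r hr
    by_cases hrα : α + 1 ≤ r
    · have hmem : r ∈ largeZeros α (Q K γ) := by
        rw [← Multiset.mem_coe, coe_largeZeros]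
        exact Multiset.mem_filter.2 ⟨hr, hrα⟩
      have := lt_of_threshold_le hn (θ := r) (by simpa using hmem)
      push_cast at this
      linarith
    · have := m.cast_nonneg (α := ℝ)
      linarith)
  rwa [← hprod, hcard, ← q_eq_aeval] at h

/-- The factor that belongs to the largest zero of `Q` may have any constant if it is applied
last, because the zeros of its output need not be positive. -/
theorem exists_hasSimpleZeros_q_of_onlyRealZeros {α : ℝ} (hα : -1 < α) {K : ℕ} {γ : ℕ → ℝ}
    (hγ : γ 0 = 1) (hQ : OnlyRealZeros (Q K γ)) {n : ℕ} (hn : threshold α K γ 1 ≤ n) :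
    ∃ u, HasSimpleZeros (q α K γ n) n u := by
  have hKn := (le_threshold α K γ 1).trans hn
  rcases (largeZeros α (Q K γ)).eq_nil_or_concat with hnil | ⟨L, θ, hL⟩
  · have h0 : threshold α K γ 0 ≤ n := by simpa [threshold, hnil] using hKn
    obtain ⟨u, hu, -⟩ := posSimple_q_of_onlyRealZeros hα hγ hQ h0
    exact ⟨u, hu⟩
  obtain ⟨m, rfl⟩ : ∃ m, n = m + K := ⟨n - K, by omega⟩
  have hprod := eq_prod_roots_of_onlyRealZeros (monic_Q hγ) hQ
  have hcard := card_roots_Q hγ hQ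
  -- All the zeros of `Q` except the largest one `θ` satisfy the bound needed for positivity.
  set s : Multiset ℝ := (Q K γ).roots.filter (fun x => ¬ α + 1 ≤ x) + (L : Multiset ℝ) with hs
  have hroots : (Q K γ).roots = θ ::ₘ s := by
    have h1 := coe_largeZeros α (Q K γ)
    have h2 : ((L ++ [θ] : List ℝ) : Multiset ℝ) = θ ::ₘ (L : Multiset ℝ) := by
      rw [← Multiset.coe_add, add_comm, Multiset.coe_singleton, Multiset.singleton_add]
    rw [hL, List.concat_eq_append, h2] at h1
    conv_lhs => rw [← Multiset.filter_add_not (fun x => α + 1 ≤ x) (Q K γ).roots, ← h1]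
    rw [Multiset.cons_add, add_comm (L : Multiset ℝ)]
  have h := (posSimple_monicLaguerre hα m).aeval_prod (c := α + m + 1) s (by
    intro r hr
    rcases Multiset.mem_add.1 hr with hr | hr
    · have := (Multiset.mem_filter.1 hr).2
      have := m.cast_nonneg (α := ℝ)
      linarith
    · have := lt_of_threshold_le hn (θ := r) (by simpa [hL] using hr)
      push_cast at this
      linarith)
  obtain ⟨u, hu⟩ := h.exists_hasSimpleZeros_neg_shiftedEulerOp (α + m + 1 - θ)
  have hsK : s.card + 1 = K := by rw [← hcard, hroots, Multiset.card_cons]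
  refine ⟨u, ?_⟩
  have hq : q α K γ (m + K) = -shiftedEulerOp (α + m + 1 - θ) ((-1 : ℝ) ^ s.card •
      aeval (shiftedEulerOp (α + m + 1)) (s.map fun r => X - C r).prod (monicLaguerre α m)) := by
    rw [q_eq_aeval, hprod, hroots, Multiset.map_cons, Multiset.prod_cons, map_mul,
      Module.End.mul_apply, aeval_shiftedEulerOp_X_sub_C, map_smul, ← hsK, pow_succ,
      mul_neg_one, neg_smul]
  rw [hq, ← hsK, ← add_assoc]
  exact hu

theorem threshold_eq {α : ℝ} {K : ℕ} {γ : ℕ → ℝ}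
    (h : ∀ x : ℝ, (Q K γ).eval x = 0 → x < α + 1) (l : ℕ) : threshold α K γ l = K := by
  have : largeZeros α (Q K γ) = [] := by
    rw [← Multiset.coe_eq_zero, coe_largeZeros, Multiset.filter_eq_nil]
    intro x hx
    exact not_le.2 (h x (mem_roots'.1 hx).2)
  simp [threshold, this]

/-! ### Combinations with non-real zeros of `Q` -/

theorem eventually_posSimple_q {α : ℝ} (hα : -1 < α) (K : ℕ) {γ : ℕ → ℝ} (hγ : γ 0 = 1) :
    ∃ N, ∀ n, N ≤ n → PosSimple (q α K γ n) n := by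
  obtain ⟨N, -, hN⟩ := exists_isLargeIndex α K γ
  refine ⟨N, fun n hn => ?_⟩
  obtain ⟨w, -, hw, -, hw0, -⟩ := (hN n hn).exists_zeros hα hγ
  exact ⟨w, hw, hw0⟩

theorem eventually_posSimple_aeval {α : ℝ} (hα : -1 < α) {R : ℝ[X]} (hR : R.Monic) :
    ∃ N : ℕ, ∀ m, N ≤ m → PosSimple ((-1 : ℝ) ^ R.natDegree •
      aeval (shiftedEulerOp (α + m + 1)) R (monicLaguerre α m)) (m + R.natDegree) := by
  obtain ⟨γ, hγ, hRγ⟩ := exists_eq_Q (le_refl R.natDegree)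
  rw [hR.coeff_natDegree] at hγ
  obtain ⟨N, hN⟩ := eventually_posSimple_q hα R.natDegree hγ
  refine ⟨N, fun m hm => ?_⟩
  have := hN (m + R.natDegree) (by omega)
  rwa [q_eq_aeval, ← hRγ] at this

/-- A monic real polynomial is the product of the linear factors that belong to its real zeros
below `α + 1` and of the monic polynomial whose complex zeros are the exceptional ones. -/
theorem exists_exceptional_factor (α : ℝ) {p : ℝ[X]} (hp : p.Monic) :
    ∃ (s : Multiset ℝ) (R : ℝ[X]), (∀ r ∈ s, r < α + 1) ∧
      p = (s.map fun r => X - C r).prod * R ∧ R.Monic ∧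
      R.map (algebraMap ℝ ℂ) = ((exceptionalZeros α p).map fun z => X - C z).prod := by
  classical
  set s := p.roots.filter fun x => ¬ α + 1 ≤ x with hs
  obtain ⟨R, hR⟩ := (Multiset.prod_X_sub_C_dvd_iff_le_roots hp.ne_zero s).2
    (Multiset.filter_le _ _)
  have hsm : (s.map fun r => X - C r).prod.Monic := monic_multiset_prod_of_monic _ _
    fun r _ => monic_X_sub_C r
  have hRm : R.Monic := hsm.of_mul_monic_left (hR ▸ hp)
  refine ⟨s, R, fun r hr => not_le.1 (Multiset.mem_filter.1 hr).2, hR, hRm, ?_⟩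
  have hroots : R.roots = p.roots.filter fun x => α + 1 ≤ x := by
    have h1 := congrArg roots hR
    rw [roots_mul (hR ▸ hp.ne_zero), roots_multiset_prod_X_sub_C] at h1
    have h2 := Multiset.filter_add_not (fun x => α + 1 ≤ x) p.roots
    rw [add_comm, ← hs] at h2
    exact (add_left_cancel (h2.trans h1)).symm
  have hexc : exceptionalZeros α p = R.aroots ℂ := by
    have hS : ((s.map fun r => X - C r).prod).aroots ℂ = s.map (algebraMap ℝ ℂ) := by
      rw [aroots_def, Polynomial.map_multiset_prod, Multiset.map_map]
      have : (s.map (Polynomial.map (algebraMap ℝ ℂ) ∘ fun r => X - C r)) =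
          ((s.map (algebraMap ℝ ℂ)).map fun z => X - C z) := by
        rw [Multiset.map_map]
        refine Multiset.map_congr rfl fun r _ => ?_
        simp
      rw [this, roots_multiset_prod_X_sub_C]
    have hp' : p.aroots ℂ = s.map (algebraMap ℝ ℂ) + R.aroots ℂ := by
      conv_lhs => rw [hR]
      rw [aroots_mul (hR ▸ hp.ne_zero), hS]
    rw [exceptionalZeros, hp', Multiset.filter_add, Multiset.filter_eq_nil.2, zero_add,
      Multiset.filter_eq_self]
    · intro z hz
      by_cases him : z.im = 0
      · right
        have hzr : z = (z.re : ℂ) := Complex.ext (by simp) (by simp [him])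
        have hre : z.re ∈ R.roots := by
          rw [mem_roots hRm.ne_zero, IsRoot.def]
          have h0 : aeval z R = 0 := (mem_aroots.1 hz).2
          rw [hzr, ← Complex.coe_algebraMap, aeval_algebraMap_apply] at h0
          simpa using h0
        rw [hroots] at hre
        exact (Multiset.mem_filter.1 hre).2
      · exact Or.inl him
    · intro z hz
      obtain ⟨r, hr, rfl⟩ := Multiset.mem_map.1 hz
      have := (Multiset.mem_filter.1 hr).2
      simpa using this
  rw [hexc]
  exact (IsAlgClosed.splits _).eq_prod_roots_of_monic (hRm.map _)

/-- The factor of `Q` with the exceptional zeros determines an index from which on it maps the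
Laguerre polynomials to polynomials with simple positive zeros, and the remaining linear factors
preserve this property for all indices. -/
theorem exists_uniform_index {α : ℝ} (hα : -1 < α) (K : ℕ) (Z : Multiset ℂ) :
    ∃ n₀ : ℕ, K ≤ n₀ ∧ ∀ γ : ℕ → ℝ, γ 0 = 1 → exceptionalZeros α (Q K γ) = Z →
      ∀ n : ℕ, n₀ ≤ n → PosSimple (q α K γ n) n := by
  by_cases hZ : ∃ R : ℝ[X], R.Monic ∧
      R.map (algebraMap ℝ ℂ) = (Z.map fun z => X - C z).prod
  swap
  · refine ⟨K, le_rfl, fun γ hγ hγZ => absurd ?_ hZ⟩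
    obtain ⟨-, R, -, -, hRm, hR⟩ := exists_exceptional_factor α (monic_Q (K := K) hγ)
    exact ⟨R, hRm, hγZ ▸ hR⟩
  obtain ⟨R, hRm, hR⟩ := hZ
  obtain ⟨N, hN⟩ := eventually_posSimple_aeval hα hRm
  refine ⟨N + K, by omega, fun γ hγ hγZ n hn => ?_⟩
  obtain ⟨m, rfl⟩ : ∃ m, n = m + K := ⟨n - K, by omega⟩
  obtain ⟨s, R', hs, hQ, -, hR'⟩ := exists_exceptional_factor α (monic_Q (K := K) hγ)
  obtain rfl : R' = R := map_injective _ (algebraMap ℝ ℂ).injective (by rw [hR', hγZ, hR])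
  have hdeg : R'.natDegree + s.card = K := by
    have := congrArg natDegree hQ
    rw [natDegree_Q hγ, (monic_multiset_prod_of_monic _ _ fun r _ => monic_X_sub_C r).natDegree_mul
      hRm, natDegree_multiset_prod_X_sub_C_eq_card] at this
    omega
  have h := (hN m (by omega)).aeval_prod (c := α + m + 1) s fun r hr => by
    have := hs r hr
    have := m.cast_nonneg (α := ℝ)
    linarith
  rwa [map_smul, smul_smul, ← pow_add, ← Module.End.mul_apply, ← map_mul, ← hQ, add_assoc m,
    add_comm s.card, hdeg, ← q_eq_aeval] at h

end LaguerreComb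

theorem theorem1p3 (α : ℝ) (hα : -1 < α) (K : ℕ) (hK : 1 ≤ K) :
    -- (1) `Q` has only real zeros
    (∀ γ : ℕ → ℝ, γ 0 = 1 → γ K ≠ 0 →
      LaguerreComb.OnlyRealZeros (LaguerreComb.Q K γ) →
        (∀ n : ℕ, LaguerreComb.threshold α K γ 1 ≤ n →
          LaguerreComb.OnlyRealZeros (LaguerreComb.q α K γ n) ∧
          LaguerreComb.OnlySimpleZeros (LaguerreComb.q α K γ n)) ∧
        (∀ n : ℕ, LaguerreComb.threshold α K γ 0 ≤ n →
          LaguerreComb.OnlyPositiveZeros (LaguerreComb.q α K γ n) ∧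
          LaguerreComb.OnlySimpleZeros (LaguerreComb.q α K γ n)) ∧
        ((∀ x : ℝ, (LaguerreComb.Q K γ).eval x = 0 → x < α + 1) →
          LaguerreComb.threshold α K γ 0 = K ∧ LaguerreComb.threshold α K γ 1 = K)) ∧
    -- (2) `Q` has non-real zeros; for the given `α` and `K`, the integer `n₀` depends only on the
    -- non-real zeros of `Q` and on its real zeros that are at least `α + 1`
    (∀ Z : Multiset ℂ, ∃ n₀ : ℕ, K ≤ n₀ ∧
      ∀ γ : ℕ → ℝ, γ 0 = 1 → γ K ≠ 0 →
        (∃ z : ℂ, Polynomial.aeval z (LaguerreComb.Q K γ) = 0 ∧ z.im ≠ 0) →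
        LaguerreComb.exceptionalZeros α (LaguerreComb.Q K γ) = Z →
        ∀ n : ℕ, n₀ ≤ n →
          LaguerreComb.OnlyPositiveZeros (LaguerreComb.q α K γ n) ∧
          LaguerreComb.OnlySimpleZeros (LaguerreComb.q α K γ n)) ∧
    -- in all the cases, the zeros of `q_{n+1}` eventually interlace those of `q_n`
    (∀ γ : ℕ → ℝ, γ 0 = 1 → γ K ≠ 0 →
      ∃ N : ℕ, K ≤ N ∧ ∀ n : ℕ, N ≤ n →
        LaguerreComb.Interlaces (LaguerreComb.q α K γ (n + 1)).roots.toFinset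
          (LaguerreComb.q α K γ n).roots.toFinset) := by
  refine ⟨fun γ hγ _ hQ => ⟨fun n hn => ?_, fun n hn => ?_, fun h => ?_⟩, fun Z => ?_,
    fun γ hγ _ => ?_⟩
  · obtain ⟨u, hu⟩ := LaguerreComb.exists_hasSimpleZeros_q_of_onlyRealZeros hα hγ hQ hn
    exact ⟨hu.onlyRealZeros, hu.onlySimpleZeros⟩
  · exact (LaguerreComb.posSimple_q_of_onlyRealZeros hα hγ hQ hn).onlyPositiveZeros_and
  · exact ⟨LaguerreComb.threshold_eq h 0, LaguerreComb.threshold_eq h 1⟩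
  · obtain ⟨n₀, hK₀, h⟩ := LaguerreComb.exists_uniform_index hα K Z
    exact ⟨n₀, hK₀, fun γ hγ _ _ hZ n hn => (h γ hγ hZ n hn).onlyPositiveZeros_and⟩
  · obtain ⟨N, hKN, hN⟩ := LaguerreComb.exists_isLargeIndex α K γ
    exact ⟨N, hKN, fun n hn => (hN n hn).interlaces (hN (n + 1) (hn.trans n.le_succ)) hα hγ⟩
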